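/- Let $0\le r\le m\le n$ and $d_1,d_2\ge 0$ be integers, and write $x=(x_0,\dots,x_r)$, $y=(y_{r+1},\dots,y_m)$, $z=(z_{m+1},\dots,z_{n+1})$. Let $F\in\mathbf{Q}[x,y,z]$ be a polynomial that is homogeneous of degree $d_1$ in $(x,y)$ and homogeneous of degree $d_2$ in $(y,z)$. Consider the affine algebraic sets $$V_1^*=\Big\{(x,y,z)\in\mathbf{C}^{n+2} : \tfrac{\partial F}{\partial x_i}=0\ (0\le i\le r),\ \tfrac{\partial F}{\partial y_j}=0\ (r<j\le m)\Big\},$$ $$V_2^*=\Big\{(x,y,z)\in\mathbf{C}^{n+2} : \tfrac{\partial F}{\partial y_j}=0\ (r<j\le m),\ \tfrac{\partial F}{\partial z_k}=0\ (m<k\le n+1)\Big\}.$$ For $x\in\mathbf{C}^{r+1}$ let $V_{2,x}^*\subset\mathbf{C}^{n-r+1}$ be the set of $(y,z)$ with $(x,y,z)\in V_2^*$, and for $z\in\mathbf{C}^{n-m+1}$ let $V_{1,z}^*\subset\mathbf{C}^{m+1}$ be the set of $(x,y)$ with $(x,y,z)\in V_1^*$. For integers $\lambda,\mu\ge 0$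 put $$\mathcal{A}_2^\lambda=\{x\in\mathbf{C}^{r+1} : \dim V_{2,x}^*<\dim V_2^*-(r+1)+\lambda\},$$ $$\mathcal{A}_1^\mu=\{z\in\mathbf{C}^{n-m+1} : \dim V_{1,z}^*<\dim V_1^*-(n-m+1)+\mu\},$$ where $\dim\emptyset=-\infty$ and $-\infty<-\infty$ is false. Then, for all $\lambda,\mu\ge0$: (1) $\mathcal{A}_2^\lambda$ is Zariski open in $\mathbf{A}_{\mathbf{C}}^{r+1}$ and, if $V_2^*\neq\emptyset$, there is a constant $C>0$ depending only on $r,m,n,F,\lambda$ such that for every real $P_1\ge1$ $$\mathrm{Card}\big\{x\in[-P_1,P_1]^{r+1}\cap\mathbf{Z}^{r+1} : x\notin\mathcal{A}_2^\lambda\big\}\le C\,P_1^{\,r+1-\lambda}.$$ (2) $\mathcal{A}_1^\mu$ is Zariski open in $\mathbf{A}_{\mathbf{C}}^{n-m+1}$ and, if $V_1^*\neq\emptyset$, there is a constant $C>0$ depending only on $r,m,n,F,\mu$ such that for every real $P_2\ge1$ $$\mathrm{Card}\big\{z\in[-P_2,P_2]^{n-m+1}\cap\mathbf{Z}^{n-m+1}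 : z\notin\mathcal{A}_1^\mu\big\}\le C\,P_2^{\,n-m+1-\mu}.$$ (Both $V_1^*$ and $V_2^*$ contain the origin, hence are non-empty, as soon as $\max(d_1,d_2)\ge2$.) -/

import Mathlib

/-- Index set of the coordinates `x = (x₀, …, x_r)`. -/
abbrev XIdx (r : ℕ) : Type := Fin (r + 1)

/-- Index set of the coordinates `y = (y_{r+1}, …, y_m)` (used with `r ≤ m`). -/
abbrev YIdx (r m : ℕ) : Type := Fin (m - r)

/-- Index set of the coordinates `z = (z_{m+1}, …, z_{n+1})` (used with `m ≤ n`). -/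
abbrev ZIdx (m n : ℕ) : Type := Fin (n - m + 1)

/-- Index set of all the `n + 2` coordinates `(x, y, z)`. -/
abbrev XYZIdx (r m n : ℕ) : Type := XIdx r ⊕ (YIdx r m ⊕ ZIdx m n)

/-- The point of `ℂ^{n+2}` with blocks of coordinates `x`, `y`, `z`. -/
def xyzPoint {r m n : ℕ} (x : XIdx r → ℂ) (y : YIdx r m → ℂ) (z : ZIdx m n → ℂ) :
    XYZIdx r m n → ℂ :=
  Sum.elim x (Sum.elim y z)

/-- The weight that counts the degree in `(x, y)`. -/
def weightXY (r m n : ℕ) : XYZIdx r m n → ℕ :=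
  Sum.elim (fun _ => 1) (Sum.elim (fun _ => 1) (fun _ => 0))

/-- The weight that counts the degree in `(y, z)`. -/
def weightYZ (r m n : ℕ) : XYZIdx r m n → ℕ :=
  Sum.elim (fun _ => 0) (Sum.elim (fun _ => 1) (fun _ => 1))

/-- `F` is homogeneous of degree `d₁` in `(x, y)` and homogeneous of degree `d₂` in `(y, z)`. -/
def IsBihomogeneous {r m n : ℕ} (F : MvPolynomial (XYZIdx r m n) ℚ) (d₁ d₂ : ℕ) : Prop :=
  MvPolynomial.IsWeightedHomogeneous (weightXY r m n) F d₁ ∧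
    MvPolynomial.IsWeightedHomogeneous (weightYZ r m n) F d₂

/-- The value at `p ∈ ℂ^{n+2}` of the partial derivative of `F` in the variable `i`. -/
noncomputable def partialAt {r m n : ℕ} (F : MvPolynomial (XYZIdx r m n) ℚ) (i : XYZIdx r m n)
    (p : XYZIdx r m n → ℂ) : ℂ :=
  MvPolynomial.aeval p (MvPolynomial.pderiv i F)

/-- `V₁* ⊆ ℂ^{n+2}`: all `∂F/∂x_i` and all `∂F/∂y_j` vanish. -/
def V1Star {r m n : ℕ} (F : MvPolynomial (XYZIdx r m n) ℚ) : Set (XYZIdx r m n → ℂ) :=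
  {p | (∀ i : XIdx r, partialAt F (Sum.inl i) p = 0) ∧
    ∀ j : YIdx r m, partialAt F (Sum.inr (Sum.inl j)) p = 0}

/-- `V₂* ⊆ ℂ^{n+2}`: all `∂F/∂y_j` and all `∂F/∂z_k` vanish. -/
def V2Star {r m n : ℕ} (F : MvPolynomial (XYZIdx r m n) ℚ) : Set (XYZIdx r m n → ℂ) :=
  {p | (∀ j : YIdx r m, partialAt F (Sum.inr (Sum.inl j)) p = 0) ∧
    ∀ k : ZIdx m n, partialAt F (Sum.inr (Sum.inr k)) p = 0}

/-- The fibre `V*_{1,z} ⊆ ℂ^{m+1}` of `V₁*`: the `(x, y)` with `(x, y, z) ∈ V₁*`. -/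
def V1Fibre {r m n : ℕ} (F : MvPolynomial (XYZIdx r m n) ℚ) (z : ZIdx m n → ℂ) :
    Set (XIdx r ⊕ YIdx r m → ℂ) :=
  {q | xyzPoint (fun i => q (Sum.inl i)) (fun j => q (Sum.inr j)) z ∈ V1Star F}

/-- The fibre `V*_{2,x} ⊆ ℂ^{n-r+1}` of `V₂*`: the `(y, z)` with `(x, y, z) ∈ V₂*`. -/
def V2Fibre {r m n : ℕ} (F : MvPolynomial (XYZIdx r m n) ℚ) (x : XIdx r → ℂ) :
    Set (YIdx r m ⊕ ZIdx m n → ℂ) :=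
  {q | xyzPoint x (fun j => q (Sum.inl j)) (fun k => q (Sum.inr k)) ∈ V2Star F}

/-- Dimension of an algebraic subset `V` of `ℂ^σ`: the Krull dimension of its coordinate ring
`ℂ[X_σ] / I(V)`. The empty set has dimension `⊥` (that is, `-∞`). -/
noncomputable def algDim {σ : Type} (V : Set (σ → ℂ)) : WithBot ℕ∞ :=
  ringKrullDim (MvPolynomial σ ℂ ⧸ MvPolynomial.vanishingIdeal ℂ V)

/-- `U ⊆ ℂ^σ` is Zariski open: its complement is the zero locus of an ideal of polynomials. -/
def IsZariskiOpen {σ : Type} (U : Set (σ → ℂ)) : Prop :=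
  ∃ I : Ideal (MvPolynomial σ ℂ), Uᶜ = MvPolynomial.zeroLocus ℂ I

/-- `A₁^μ = {z ∈ ℂ^{n-m+1} : dim V*_{1,z} < dim V₁* - (n-m+1) + μ}`; the subtracted term is moved
to the left, so that no subtraction occurs in `WithBot ℕ∞`. -/
def A1 {r m n : ℕ} (F : MvPolynomial (XYZIdx r m n) ℚ) (μ : ℕ) : Set (ZIdx m n → ℂ) :=
  {z | algDim (V1Fibre F z) + ((n - m + 1 : ℕ) : WithBot ℕ∞) <
    algDim (V1Star F) + (μ : WithBot ℕ∞)}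

/-- `A₂^ν = {x ∈ ℂ^{r+1} : dim V*_{2,x} < dim V₂* - (r+1) + ν}`; the subtracted term is moved
to the left, so that no subtraction occurs in `WithBot ℕ∞`. -/
def A2 {r m n : ℕ} (F : MvPolynomial (XYZIdx r m n) ℚ) (ν : ℕ) : Set (XIdx r → ℂ) :=
  {x | algDim (V2Fibre F x) + ((r + 1 : ℕ) : WithBot ℕ∞) <
    algDim (V2Star F) + (ν : WithBot ℕ∞)}

/-- The integer points of `[-P, P]^k` that lie in the subset `S` of `ℂ^k`. -/
def boxIntPoints {k : ℕ} (S : Set (Fin k → ℂ)) (P : ℝ) : Set (Fin k → ℤ) :=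
  {a | (∀ i, |(a i : ℝ)| ≤ P) ∧ (fun i => (a i : ℂ)) ∈ S}

/-! Both parts concern a family of cones. For (2), the roles of the blocks are exchanged, so take
(1). The equations are homogeneous in (y, z), so each fibre over x is a cone, and being homogeneous
in (x, y) they are stable under (x, y, z) ↦ (tx, ty, z). Hence the locus Z where the fibre has
dimension at least k is itself stable under dilation.

Dimension is handled through `IsCutBy`: a closed cone has dimension at least k + 1 exactly when no k
integral linear forms cut it down to the origin (`not_isCutBy_iff`). If k forms do, the coordinate
ring is finite over the polynomial ring in k variables; if none do, generic integral hyperplane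
sections lower the dimension k + 1 times. Performing the sections on the total space gives dim Z + k
≤ dim V (`algDim_add_le_of_not_isCutBy`), and a Nakayama argument shows that Z is closed
(`exists_eval_ne_zero_of_familyFibre_subset`).

With k = dim V + ν - (r + 1) this yields dim Z ≤ r + 1 - ν. Finally, a closed cone of dimension e
has O(P^e) integer points in the box: e integral linear forms map them with bounded fibres into a
box in ℤ^e (`exists_ncard_boxIntPoints_le`). -/

open MvPolynomial

/-! ### Integral linear forms and dimension -/

/-- The linear form with integer coefficients `a`. -/
noncomputable def linForm (R : Type*) [CommRing R] {τ : Type*} [Fintype τ] (a : τ → ℤ) :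
    MvPolynomial τ R :=
  ∑ j, C (a j : R) * X j

theorem isHomogeneous_linForm (R : Type*) [CommRing R] {τ : Type*} [Fintype τ] (a : τ → ℤ) :
    (linForm R a).IsHomogeneous 1 :=
  IsHomogeneous.sum _ _ _ fun _ _ => isHomogeneous_C_mul_X _ _

theorem eval_linForm {R : Type*} [CommRing R] {τ : Type*} [Fintype τ] (a : τ → ℤ) (y : τ → R) :
    eval y (linForm R a) = ∑ j, (a j : R) * y j := by
  simp [linForm]

theorem map_linForm {R S : Type*} [CommRing R] [CommRing S] {τ : Type*} [Fintype τ] (f : R →+* S)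
    (a : τ → ℤ) : map f (linForm R a) = linForm S a := by
  simp [linForm]

/-- Stability under scaling by nonzero complex numbers. -/
def IsCone {τ : Type*} (W : Set (τ → ℂ)) : Prop :=
  ∀ t : ℂ, t ≠ 0 → ∀ y ∈ W, t • y ∈ W

/-- Some `k` linear forms with integer coefficients have no common zero on `W` except `0`. -/
def IsCutBy {τ : Type*} [Fintype τ] (k : ℕ) (W : Set (τ → ℂ)) : Prop :=
  ∃ a : Fin k → τ → ℤ, ∀ y ∈ W, (∀ i, ∑ j, (a i j : ℂ) * y j = 0) → y = 0

theorem algDim_le_of_surjective {σ τ : Type} {V : Set (σ → ℂ)} {W : Set (τ → ℂ)}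
    (φ : MvPolynomial σ ℂ →ₐ[ℂ] MvPolynomial τ ℂ) (hφ : Function.Surjective φ)
    (h : ∀ f ∈ vanishingIdeal ℂ V, φ f ∈ vanishingIdeal ℂ W) : algDim W ≤ algDim V :=
  ringKrullDim_le_of_surjective (Ideal.quotientMap _ φ.toRingHom h)
    (Ideal.quotientMap_surjective hφ)

theorem algDim_empty {σ : Type} : algDim (∅ : Set (σ → ℂ)) = ⊥ := by
  unfold algDim
  rw [vanishingIdeal_empty]
  exact ringKrullDim_eq_bot_of_subsingleton

theorem algDim_nonneg {σ : Type} {V : Set (σ → ℂ)} (h : V.Nonempty) : 0 ≤ algDim V := by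
  unfold algDim
  have : Nontrivial (MvPolynomial σ ℂ ⧸ vanishingIdeal ℂ V) := by
    refine Ideal.Quotient.nontrivial_iff.mpr fun h1 => ?_
    obtain ⟨x, hx⟩ := h
    have := (Ideal.eq_top_iff_one _).1 h1 x hx
    simp at this
  exact ringKrullDim_nonneg_of_nontrivial

theorem algDim_le_card {σ : Type} [Fintype σ] (V : Set (σ → ℂ)) :
    algDim V ≤ (Fintype.card σ : ℕ) := by
  refine (ringKrullDim_quotient_le _).trans ?_
  rw [MvPolynomial.ringKrullDim_of_isNoetherianRing, ringKrullDim_eq_zero_of_field]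
  simp

theorem exists_algDim_eq {σ : Type} [Fintype σ] {V : Set (σ → ℂ)} (h : V.Nonempty) :
    ∃ N : ℕ, algDim V = N := by
  have h0 := algDim_nonneg h
  have h1 := algDim_le_card V
  generalize algDim V = d at *
  induction d using WithBot.recBotCoe with
  | bot => simp at h0
  | coe d =>
    induction d using ENat.recTopCoe with
    | top => exact absurd (WithBot.coe_le_coe.1 h1) (by simp)
    | coe d => exact ⟨d, rfl⟩

/-- By incomparability, contraction of primes along an integral map is strictly monotone;
injectivity is not needed for this inequality. -/
theorem ringKrullDim_le_of_ringHom_isIntegral {R S : Type*} [CommRing R] [CommRing S] (f : R →+* S)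
    (hf : f.IsIntegral) : ringKrullDim S ≤ ringKrullDim R := by
  let := f.toAlgebra
  have : Algebra.IsIntegral R S := ⟨hf⟩
  refine Order.krullDim_le_of_strictMono (fun p : PrimeSpectrum S => PrimeSpectrum.comap f p) ?_
  intro p q hpq
  obtain ⟨x, hxq, hxp⟩ := Set.exists_of_ssubset (show (p.asIdeal : Set S) ⊂ q.asIdeal from hpq)
  exact Ideal.comap_lt_comap_of_integral_mem_sdiff (R := R) hpq.le ⟨hxq, hxp⟩
    (Algebra.IsIntegral.isIntegral x)

/-! ### Cones cut down to the origin: finiteness over linear forms -/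

theorem aeval_weight_scale {R K ι : Type*} [CommRing R] [CommRing K] [Algebra R K] {w : ι → ℕ}
    {d : ℕ} {p : MvPolynomial ι R} (hp : IsWeightedHomogeneous w p d) (t : K) (y : ι → K) :
    aeval (fun i => t ^ w i * y i) p = t ^ d * aeval y p := by
  rw [aeval_def, aeval_def, eval₂_eq, eval₂_eq, Finset.mul_sum]
  refine Finset.sum_congr rfl fun s hs => ?_
  have h1 : Finsupp.weight w s = d := hp (mem_support_iff.1 hs)
  rw [← h1, Finsupp.weight_apply, Finsupp.sum, ← Finset.prod_pow_eq_pow_sum, mul_left_comm,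
    ← Finset.prod_mul_distrib]
  congr 1
  refine Finset.prod_congr rfl fun i _ => ?_
  rw [mul_pow, smul_eq_mul, mul_comm (s i), pow_mul]

theorem eval_smul_of_isHomogeneous {K ι : Type*} [CommRing K] {d : ℕ} {p : MvPolynomial ι K}
    (hp : p.IsHomogeneous d) (t : K) (y : ι → K) : eval (t • y) p = t ^ d * eval y p := by
  have := aeval_weight_scale (K := K) hp t y
  simpa [aeval_eq_eval, Pi.smul_def] using this

/-- For fixed y in W, f(ty) is a polynomial in t vanishing at all t ≠ 0, and its coefficients are
the values at y of the homogeneous components. -/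
theorem homogeneousComponent_mem_vanishingIdeal {τ : Type} {W : Set (τ → ℂ)} (hW : IsCone W)
    {f : MvPolynomial τ ℂ} (hf : f ∈ vanishingIdeal ℂ W) (n : ℕ) :
    homogeneousComponent n f ∈ vanishingIdeal ℂ W := by
  intro y hy
  have key : ∀ t : ℂ, t ≠ 0 →
      (∑ i ∈ Finset.range (f.totalDegree + 1),
        Polynomial.C (eval y (homogeneousComponent i f)) * Polynomial.X ^ i).eval t = 0 := by
    intro t ht
    have h1 := hf (t • y) (hW t ht y hy)
    rw [← sum_homogeneousComponent f, map_sum] at h1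
    rw [Polynomial.eval_finsetSum, ← h1]
    refine Finset.sum_congr rfl fun i _ => ?_
    have h2 := eval_smul_of_isHomogeneous (homogeneousComponent_isHomogeneous i f) t y
    rw [Polynomial.eval_mul, Polynomial.eval_C, Polynomial.eval_pow, Polynomial.eval_X, mul_comm]
    exact h2.symm
  have h0 : (∑ i ∈ Finset.range (f.totalDegree + 1),
      Polynomial.C (eval y (homogeneousComponent i f)) * Polynomial.X ^ i) = 0 := by
    refine Polynomial.eq_zero_of_infinite_isRoot _
      (Set.Infinite.mono (s := {t : ℂ | t ≠ 0}) (fun t ht => key t ht) ?_)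
    exact (Set.finite_singleton (0 : ℂ)).infinite_compl
  by_cases hn : f.totalDegree < n
  · rw [homogeneousComponent_eq_zero _ _ hn, map_zero]
  · have := congrArg (fun p => Polynomial.coeff p n) h0
    simpa [Polynomial.finsetSum_coeff, Polynomial.coeff_C_mul, Polynomial.coeff_X_pow,
      Nat.lt_succ_iff, not_lt.1 hn] using this

/-- By the Nullstellensatz the ideal of the variables lies in the radical of J, so a power of it
lies in J. -/
theorem exists_forall_isHomogeneous_mem {τ : Type} [Finite τ] {J : Ideal (MvPolynomial τ ℂ)}
    (h : ∀ y ∈ zeroLocus ℂ J, y = 0) :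
    ∃ N : ℕ, ∀ d, N ≤ d → ∀ p : MvPolynomial τ ℂ, p.IsHomogeneous d → p ∈ J := by
  have h1 : idealOfVars τ ℂ ≤ J.radical := by
    rw [Ideal.span_le, ← vanishingIdeal_zeroLocus_eq_radical (K := ℂ)]
    rintro _ ⟨j, rfl⟩ y hy
    simp [h y hy]
  obtain ⟨N, hN⟩ := Ideal.exists_pow_le_of_le_radical_of_fg h1 (idealOfVars_fg τ ℂ)
  refine ⟨N, fun d hd p hp => hN ?_⟩
  rw [mem_pow_idealOfVars_iff]
  intro x hx
  rwa [hp.degree_eq_sum_deg_support hx] at hd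

attribute [local instance] MvPolynomial.gradedAlgebra in
theorem homogeneousComponent_mul_of_isHomogeneous {R τ : Type*} [CommRing R]
    {g : MvPolynomial τ R} {m : ℕ} (hg : g.IsHomogeneous m) (h : MvPolynomial τ R) (d : ℕ) :
    homogeneousComponent (m + d) (g * h) = g * homogeneousComponent d h := by
  have e : ∀ (p : MvPolynomial τ R) (i : ℕ),
      (DirectSum.decompose (homogeneousSubmodule τ R) p i : MvPolynomial τ R) =
        homogeneousComponent i p := decomposition.decompose'_apply
  rw [← e, ← e]
  exact DirectSum.coe_decompose_mul_add_of_left_mem (homogeneousSubmodule τ R) hg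

/-- If the common zeros of the linear forms on the zero locus of a homogeneous ideal `I` reduce
to `0`, then forms of high degree lie in the ideal of the linear forms, modulo `I`. -/
theorem exists_sub_sum_linForm_mul_mem {τ : Type} [Fintype τ] {k : ℕ}
    {I : Ideal (MvPolynomial τ ℂ)} (hI : ∀ f ∈ I, ∀ n, homogeneousComponent n f ∈ I)
    {a : Fin k → τ → ℤ}
    (h : ∀ y ∈ zeroLocus ℂ I, (∀ i, ∑ j, (a i j : ℂ) * y j = 0) → y = 0) :
    ∃ N : ℕ, ∀ d, N ≤ d → ∀ p : MvPolynomial τ ℂ, p.IsHomogeneous (1 + d) →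
      ∃ q : Fin k → MvPolynomial τ ℂ, (∀ i, (q i).IsHomogeneous d) ∧
        p - ∑ i, linForm ℂ (a i) * q i ∈ I := by
  obtain ⟨N, hN⟩ := exists_forall_isHomogeneous_mem
    (J := I ⊔ Ideal.span (Set.range fun i => linForm ℂ (a i))) (by
      intro y hy
      refine h y (fun f hf => hy f (Ideal.mem_sup_left hf)) fun i => ?_
      have := hy _ (Ideal.mem_sup_right (Ideal.subset_span ⟨i, rfl⟩))
      rwa [aeval_eq_eval, eval_linForm] at this)
  refine ⟨N, fun d hd p hp => ?_⟩
  obtain ⟨g, hg, l, hl, hgl⟩ := Submodule.mem_sup.1 (hN (1 + d) (by lia) p hp)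
  obtain ⟨c, rfl⟩ := (Ideal.mem_span_range_iff_exists_fun).1 hl
  refine ⟨fun i => homogeneousComponent d (c i), fun i => homogeneousComponent_isHomogeneous _ _,
    ?_⟩
  have := congrArg (homogeneousComponent (1 + d)) hgl
  rw [map_add, map_sum, homogeneousComponent_eq_self hp] at this
  rw [← this, add_sub_assoc, ← Finset.sum_sub_distrib, Finset.sum_eq_zero, add_zero]
  · exact hI g hg _
  · intro i _
    rw [mul_comm, homogeneousComponent_mul_of_isHomogeneous (isHomogeneous_linForm _ _), sub_self]

/-- The map `T_i ↦ ℓ_i` from a polynomial ring to the coordinate ring of `W`. -/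
noncomputable def linFormsMap {τ : Type} [Fintype τ] {k : ℕ} (I : Ideal (MvPolynomial τ ℂ))
    (a : Fin k → τ → ℤ) : MvPolynomial (Fin k) ℂ →ₐ[ℂ] MvPolynomial τ ℂ ⧸ I :=
  (Ideal.Quotient.mkₐ ℂ I).comp (aeval fun i => linForm ℂ (a i))

/-- A quotient of a polynomial ring in which all forms of high degree can be expressed through
forms of lower degree is integral over the ring of coefficients needed. -/
theorem isIntegral_of_reduction {A B τ K : Type*} [CommRing A] [CommRing B] [CommRing K]
    [Algebra A B] [Finite τ] {k : ℕ} (π : MvPolynomial τ K →+* B) (hπ : Function.Surjective π)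
    (hC : ∀ c, ∃ u : A, algebraMap A B u = π (C c)) (t : Fin k → A) (N : ℕ)
    (hN : ∀ d, N ≤ d → ∀ p : MvPolynomial τ K, p.IsHomogeneous (1 + d) →
      ∃ q : Fin k → MvPolynomial τ K, (∀ i, (q i).IsHomogeneous d) ∧
        π p = ∑ i, algebraMap A B (t i) * π (q i)) :
    Algebra.IsIntegral A B := by
  -- The span of the finitely many monomials of degree at most N is everything: `hN` lowers the
  -- degree of any form above N by one.
  let M : Submodule A B :=
    Submodule.span A ((fun s => π (monomial s 1)) '' {s : τ →₀ ℕ | s.degree ≤ N})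
  have hlow : ∀ d ≤ N, ∀ p : MvPolynomial τ K, p.IsHomogeneous d → π p ∈ M := by
    intro d hd p hp
    rw [p.as_sum, map_sum]
    refine Submodule.sum_mem _ fun s hs => ?_
    obtain ⟨u, hu⟩ := hC (coeff s p)
    have : π (monomial s (coeff s p)) = u • π (monomial s 1) := by
      rw [Algebra.smul_def, hu, ← map_mul, C_mul_monomial, mul_one]
    rw [this]
    refine Submodule.smul_mem _ _ (Submodule.subset_span ⟨s, ?_, rfl⟩)
    exact (not_imp_comm.1 hp.coeff_eq_zero (mem_support_iff.1 hs)).le.trans hd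
  have hall : ∀ d, ∀ p : MvPolynomial τ K, p.IsHomogeneous d → π p ∈ M := by
    intro d
    induction d with
    | zero => exact hlow 0 (Nat.zero_le _)
    | succ d ih =>
      by_cases hd : d + 1 ≤ N
      · exact hlow _ hd
      intro p hp
      obtain ⟨q, hq, hpq⟩ := hN d (by lia) p (by rwa [add_comm])
      rw [hpq]
      refine Submodule.sum_mem _ fun i _ => ?_
      rw [← Algebra.smul_def]
      exact Submodule.smul_mem _ _ (ih _ (hq i))
  have hM : M = ⊤ := by
    rw [eq_top_iff]
    intro x _
    obtain ⟨p, rfl⟩ := hπ x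
    rw [← sum_homogeneousComponent p, map_sum]
    exact Submodule.sum_mem _ fun i _ => hall i _ (homogeneousComponent_isHomogeneous i p)
  have : Module.Finite A B :=
    ⟨hM ▸ Submodule.fg_span (Set.Finite.image _ (Finsupp.finite_of_degree_le N))⟩
  exact Algebra.IsIntegral.of_finite _ _

/-- Graded Noether normalisation: modulo I, forms of high degree lie in the ideal of the linear
forms. -/
theorem linFormsMap_isIntegral {τ : Type} [Fintype τ] {k : ℕ}
    {I : Ideal (MvPolynomial τ ℂ)} (hI : ∀ f ∈ I, ∀ n, homogeneousComponent n f ∈ I)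
    {a : Fin k → τ → ℤ}
    (h : ∀ y ∈ zeroLocus ℂ I, (∀ i, ∑ j, (a i j : ℂ) * y j = 0) → y = 0) :
    (linFormsMap I a).toRingHom.IsIntegral := by
  obtain ⟨N, hN⟩ := exists_sub_sum_linForm_mul_mem hI h
  refine (@isIntegral_of_reduction _ _ _ _ _ _ _ (linFormsMap I a).toRingHom.toAlgebra _ k
    (Ideal.Quotient.mk I) Ideal.Quotient.mk_surjective ?_ X N ?_).isIntegral
  · refine fun c => ⟨C c, ?_⟩
    change linFormsMap I a (C c) = _
    simp [linFormsMap, algHom_C]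
    rfl
  · intro d hd p hp
    obtain ⟨q, hq, hpq⟩ := hN d hd p hp
    refine ⟨q, hq, ?_⟩
    rw [← Ideal.Quotient.eq_zero_iff_mem, map_sub, sub_eq_zero] at hpq
    rw [hpq, map_sum]
    refine Finset.sum_congr rfl fun i _ => ?_
    change _ = linFormsMap I a (X i) * _
    simp [linFormsMap]

theorem algDim_le_of_isCutBy {τ : Type} [Fintype τ] {k : ℕ} {W : Set (τ → ℂ)} (hW : IsCone W)
    (hcl : zeroLocus ℂ (vanishingIdeal ℂ W) ⊆ W) (h : IsCutBy k W) : algDim W ≤ (k : ℕ) := by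
  obtain ⟨a, ha⟩ := h
  have := ringKrullDim_le_of_ringHom_isIntegral _ (linFormsMap_isIntegral
    (fun f hf n => homogeneousComponent_mem_vanishingIdeal hW hf n) fun y hy => ha y (hcl hy))
  refine this.trans ?_
  rw [MvPolynomial.ringKrullDim_of_isNoetherianRing, ringKrullDim_eq_zero_of_field]
  simp

/-! ### Generic integral hyperplane sections -/

/-- The vectors a whose combination falls in P form a subgroup of ℤ^τ. If finitely many such
subgroups cover ℤ^τ, one has finite index (B. H. Neumann); it contains a positive multiple of each
basis vector, and dividing by that integer puts every u j in P. -/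
theorem exists_int_combination_notMem {R τ : Type*} [CommRing R] [Algebra ℚ R] [Fintype τ]
    (s : Finset (Ideal R)) (u : τ → R) (h : ∀ P ∈ s, ∃ j, u j ∉ P) :
    ∃ a : τ → ℤ, ∀ P ∈ s, ∑ j, a j • u j ∉ P := by
  classical
  by_contra! hc
  let p : Ideal R → Submodule ℤ (τ → ℤ) := fun P =>
    (P.restrictScalars ℤ).comap (Fintype.linearCombination ℤ u)
  have hp : ∀ P a, a ∈ p P ↔ ∑ j, a j • u j ∈ P := fun P a => by
    simp [p, Fintype.linearCombination_apply]
  obtain ⟨P, hP, hfin⟩ := Submodule.exists_finiteIndex_of_cover (p := p) (s := s) (by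
    refine Set.eq_univ_of_forall fun a => ?_
    obtain ⟨P, hP, ha⟩ := hc a
    exact Set.mem_biUnion hP ((hp P a).2 ha))
  obtain ⟨j, hj⟩ := h P hP
  have h1 := (p P).toAddSubgroup.nsmul_index_mem (Pi.single j (1 : ℤ))
  have h2 := (hp P _).1 h1
  have h3 : ∑ i, ((p P).toAddSubgroup.index • (Pi.single j (1 : ℤ) : τ → ℤ)) i • u i =
      (p P).toAddSubgroup.index • u j := by
    rw [Finset.sum_eq_single j]
    · simp
    · intro i _ hi
      simp [hi]
    · simp
  rw [h3] at h2
  apply hj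
  have h4 : u j = algebraMap ℚ R ((p P).toAddSubgroup.index : ℚ)⁻¹ *
      ((p P).toAddSubgroup.index • u j) := by
    rw [nsmul_eq_mul, ← mul_assoc, ← map_natCast (algebraMap ℚ R), ← map_mul,
      inv_mul_cancel₀ (Nat.cast_ne_zero.2 hfin.index_ne_zero), map_one, one_mul]
  rw [h4]
  exact P.mul_mem_left _ h2

theorem isRadical_vanishingIdeal {σ : Type} (S : Set (σ → ℂ)) : (vanishingIdeal ℂ S).IsRadical := by
  rintro f ⟨n, hn⟩ x hx
  have := hn x hx
  rw [map_pow] at this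
  exact eq_zero_of_pow_eq_zero this

theorem mem_vanishingIdeal_of_forall_minimalPrimes {σ : Type} {S : Set (σ → ℂ)}
    {f : MvPolynomial σ ℂ} (h : ∀ P ∈ (vanishingIdeal ℂ S).minimalPrimes, f ∈ P) :
    f ∈ vanishingIdeal ℂ S := by
  rw [← (isRadical_vanishingIdeal S).radical, ← Ideal.sInf_minimalPrimes]
  exact Submodule.mem_sInf.2 h

/-- The vanishing ideal is radical, so an element outside all its minimal primes is a nonzerodivisor
on the quotient, and killing it lowers the dimension. -/
theorem algDim_add_one_le {σ τ : Type} {S : Set (σ → ℂ)} {T : Set (τ → ℂ)}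
    (φ : MvPolynomial σ ℂ →ₐ[ℂ] MvPolynomial τ ℂ) (hφ : Function.Surjective φ)
    (h : ∀ f ∈ vanishingIdeal ℂ S, φ f ∈ vanishingIdeal ℂ T) (f : MvPolynomial σ ℂ)
    (hf : ∀ P ∈ (vanishingIdeal ℂ S).minimalPrimes, f ∉ P) (hfT : φ f ∈ vanishingIdeal ℂ T) :
    algDim T + 1 ≤ algDim S := by
  refine ringKrullDim_succ_le_of_surjective (Ideal.quotientMap _ φ.toRingHom h)
    (Ideal.quotientMap_surjective hφ) (r := Ideal.Quotient.mk _ f) ?_ ?_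
  · rw [mem_nonZeroDivisors_iff_right]
    intro x hx
    obtain ⟨g, rfl⟩ := Ideal.Quotient.mk_surjective x
    rw [← map_mul, Ideal.Quotient.eq_zero_iff_mem] at hx
    rw [Ideal.Quotient.eq_zero_iff_mem]
    refine mem_vanishingIdeal_of_forall_minimalPrimes fun P hP => ?_
    exact (hP.1.1.mem_or_mem (hP.1.2 hx)).resolve_right (hf P hP)
  · exact Ideal.Quotient.eq_zero_iff_mem.2 hfT

/-- If at each point of `S` some `u j` is nonzero, then no component of the closure of `S` lies in
the common zero locus of the `u j`. -/
theorem exists_notMem_of_mem_minimalPrimes {σ τ : Type} [Finite σ] {S : Set (σ → ℂ)}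
    (u : τ → MvPolynomial σ ℂ) (h : ∀ p ∈ S, ∃ j, eval p (u j) ≠ 0)
    {P : Ideal (MvPolynomial σ ℂ)} (hP : P ∈ (vanishingIdeal ℂ S).minimalPrimes) :
    ∃ j, u j ∉ P := by
  classical
  by_contra! hc
  have hfin := (vanishingIdeal ℂ S).finite_minimalPrimes_of_isNoetherianRing
  -- Choose g vanishing on every component except that of P. If all u j were in P, each g * u j
  -- would vanish on S, hence so would g, forcing g ∈ P.
  obtain ⟨g, hg, hgP⟩ : ∃ g ∈ (hfin.toFinset.erase P).inf id, g ∉ P := by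
    by_contra! hle
    obtain ⟨Q, hQ, hQP⟩ := (Ideal.IsPrime.inf_le' hP.1.1).1 hle
    rw [Finset.mem_erase, Set.Finite.mem_toFinset] at hQ
    exact hQ.1 (le_antisymm hQP (hP.2 hQ.2.1 hQP))
  refine hgP (hP.1.2 fun p hp => ?_)
  obtain ⟨j, hj⟩ := h p hp
  have h1 : g * u j ∈ vanishingIdeal ℂ S := by
    refine mem_vanishingIdeal_of_forall_minimalPrimes fun Q hQ => ?_
    by_cases hQP : Q = P
    · exact hQP ▸ P.mul_mem_left _ (hc j)
    · have : (hfin.toFinset.erase P).inf id ≤ Q :=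
        Finset.inf_le (f := id) (Finset.mem_erase.2 ⟨hQP, hfin.mem_toFinset.2 hQ⟩)
      exact Q.mul_mem_right _ (this hg)
  have h2 := h1 p hp
  rw [aeval_eq_eval, map_mul] at h2
  exact (mul_eq_zero.1 h2).resolve_right hj

theorem eval_zero_section_eq_zero {σ τ : Type} {g : MvPolynomial (σ ⊕ τ) ℂ} {x : σ → ℂ}
    {y : τ → ℂ} (h : ∀ t : ℂ, t ≠ 0 → eval (Sum.elim x (t • y)) g = 0) :
    eval (Sum.elim x 0) g = 0 := by
  let p : Polynomial ℂ :=
    aeval (Sum.elim (fun i => Polynomial.C (x i)) fun j => Polynomial.C (y j) * Polynomial.X) g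
  have hp : ∀ t : ℂ, p.eval t = eval (Sum.elim x (t • y)) g := by
    intro t
    refine RingHom.congr_fun (f := (Polynomial.evalRingHom t).comp
      (aeval _ : MvPolynomial (σ ⊕ τ) ℂ →ₐ[ℂ] Polynomial ℂ).toRingHom)
      (MvPolynomial.ringHom_ext (fun c => ?_) fun i => ?_) g
    · simp
    · cases i with
      | inl i => simp
      | inr j => simpa using mul_comm _ _
  have h0 : p = 0 := Polynomial.eq_zero_of_infinite_isRoot _
    (Set.Infinite.mono (s := {t : ℂ | t ≠ 0}) (fun t ht => (hp t).trans (h t ht))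
      (Set.finite_singleton (0 : ℂ)).infinite_compl)
  have := hp 0
  rw [h0, zero_smul, Polynomial.eval_zero] at this
  exact this.symm

/-- A generic integral linear form lowers the dimension of a set on which `τ`-coordinates do not
vanish simultaneously. -/
theorem exists_linForm_algDim_add_one_le {σ τ : Type} [Fintype σ] [Fintype τ]
    (S : Set (σ ⊕ τ → ℂ)) (hS : ∀ x : σ → ℂ, Sum.elim x (0 : τ → ℂ) ∉ S) :
    ∃ a : τ → ℤ, ∀ (κ : Type) (T : Set (κ → ℂ)) (φ : MvPolynomial (σ ⊕ τ) ℂ →ₐ[ℂ] MvPolynomial κ ℂ),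
      Function.Surjective φ → (∀ f ∈ vanishingIdeal ℂ S, φ f ∈ vanishingIdeal ℂ T) →
      φ (∑ j, a j • X (Sum.inr j)) ∈ vanishingIdeal ℂ T → algDim T + 1 ≤ algDim S := by
  have hfin := (vanishingIdeal ℂ S).finite_minimalPrimes_of_isNoetherianRing
  obtain ⟨a, ha⟩ := exists_int_combination_notMem hfin.toFinset
    (fun j : τ => (X (Sum.inr j) : MvPolynomial (σ ⊕ τ) ℂ)) (by
      intro P hP
      refine exists_notMem_of_mem_minimalPrimes _ (fun p hp => ?_) (hfin.mem_toFinset.1 hP)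
      by_contra! h0
      apply hS (p ∘ Sum.inl)
      convert hp
      ext i
      cases i with
      | inl i => rfl
      | inr j => simpa using (h0 j).symm)
  exact ⟨a, fun κ T φ hφ h hfT =>
    algDim_add_one_le φ hφ h _ (fun P hP => ha P (hfin.mem_toFinset.2 hP)) hfT⟩

theorem algDim_mono {σ : Type} {S T : Set (σ → ℂ)} (h : S ⊆ T) : algDim S ≤ algDim T :=
  algDim_le_of_surjective (AlgHom.id ℂ _) Function.surjective_id
    fun _ hf => vanishingIdeal_anti_mono h hf

theorem zeroSection_surjective (σ τ : Type) : Function.Surjective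
    (aeval (Sum.elim X 0) : MvPolynomial (σ ⊕ τ) ℂ →ₐ[ℂ] MvPolynomial σ ℂ) := fun p =>
  ⟨rename Sum.inl p, by rw [aeval_rename]; exact aeval_X_left_apply p⟩

/-- Letting t → 0 along (x, ty) shows that Z × {0} lies in the Zariski closure of S, even if S
contains no point with y = 0. -/
theorem aeval_zeroSection_mem {σ τ : Type} {Z : Set (σ → ℂ)} {S : Set (σ ⊕ τ → ℂ)}
    (hS : ∀ t : ℂ, t ≠ 0 → ∀ x y, Sum.elim x y ∈ S → Sum.elim x (t • y) ∈ S)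
    (h : ∀ x ∈ Z, ∃ y, Sum.elim x y ∈ S) {f : MvPolynomial (σ ⊕ τ) ℂ}
    (hf : f ∈ vanishingIdeal ℂ S) :
    (aeval (Sum.elim X 0) : MvPolynomial (σ ⊕ τ) ℂ →ₐ[ℂ] MvPolynomial σ ℂ) f ∈
      vanishingIdeal ℂ Z := by
  intro x hx
  obtain ⟨y, hy⟩ := h x hx
  rw [← eval_zero_section_eq_zero (g := f) (x := x) (y := y) fun t ht => hf _ (hS t ht x y hy)]
  rw [← AlgHom.comp_apply, comp_aeval, aeval_eq_eval]
  congr 2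
  ext i
  cases i <;> simp

theorem algDim_le_of_fibre_nonempty {σ τ : Type} (Z : Set (σ → ℂ)) (S : Set (σ ⊕ τ → ℂ))
    (hS : ∀ t : ℂ, t ≠ 0 → ∀ x y, Sum.elim x y ∈ S → Sum.elim x (t • y) ∈ S)
    (h : ∀ x ∈ Z, ∃ y, Sum.elim x y ∈ S) : algDim Z ≤ algDim S :=
  algDim_le_of_surjective _ (zeroSection_surjective σ τ) fun _ hf => aeval_zeroSection_mem hS h hf

/-- If no fibre over `Z` of a family `S` of cones is cut down to the origin by `k` linear forms,
then the total space has dimension at least `dim Z + k + 1`. -/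
theorem algDim_add_le_of_not_isCutBy {σ τ : Type} [Fintype σ] [Fintype τ] (Z : Set (σ → ℂ))
    (k : ℕ) (S : Set (σ ⊕ τ → ℂ))
    (hS : ∀ t : ℂ, t ≠ 0 → ∀ x y, Sum.elim x y ∈ S → Sum.elim x (t • y) ∈ S)
    (h : ∀ x ∈ Z, ¬ IsCutBy k {y : τ → ℂ | Sum.elim x y ∈ S}) :
    algDim Z + ((k + 1 : ℕ) : WithBot ℕ∞) ≤ algDim S := by
  induction k generalizing S with
  | zero =>
    -- Deleting the zero section keeps the fibres over Z nonempty. Its closure still contains Z ×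
    -- {0}, on which the generic form vanishes: this gains the extra 1.
    obtain ⟨a, ha⟩ := exists_linForm_algDim_add_one_le {p ∈ S | p ∘ Sum.inr ≠ 0} (by simp)
    refine (ha σ Z _ (zeroSection_surjective σ τ) (fun f hf => ?_) (by simp)).trans
      (algDim_mono fun p hp => hp.1)
    refine aeval_zeroSection_mem (S := {p ∈ S | p ∘ Sum.inr ≠ 0})
      (fun t ht x y hy => ⟨hS t ht x y hy.1, ?_⟩) (fun x hx => ?_) hf
    · simpa [ht] using hy.2
    · by_contra! hc
      refine h x hx ⟨fun i => i.elim0, fun y hy _ => ?_⟩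
      by_contra hy0
      exact hc y ⟨hy, by simpa using hy0⟩
  | succ k ih =>
    obtain ⟨a, ha⟩ := exists_linForm_algDim_add_one_le {p ∈ S | p ∘ Sum.inr ≠ 0} (by simp)
    have h1 := ha _ {p ∈ S | p ∘ Sum.inr ≠ 0 ∧ ∑ j, (a j : ℂ) * p (Sum.inr j) = 0} (AlgHom.id ℂ _)
      Function.surjective_id
      (fun f hf p hp => hf p ⟨hp.1, hp.2.1⟩) (by
        rintro p ⟨-, -, hp⟩
        simpa using hp)
    -- If k forms cut a fibre of the section down to the origin, then adjoining a gives k + 1 forms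
    -- cutting the original fibre.
    have h2 := ih {p ∈ S | p ∘ Sum.inr ≠ 0 ∧ ∑ j, (a j : ℂ) * p (Sum.inr j) = 0} (by
        rintro t ht x y ⟨h3, h4, h5⟩
        refine ⟨hS t ht x y h3, by simpa [ht] using h4, ?_⟩
        simp only [Sum.elim_inr, Pi.smul_apply, smul_eq_mul, mul_left_comm _ t] at h5 ⊢
        rw [← Finset.mul_sum, h5, mul_zero]) (by
        rintro x hx ⟨b, hb⟩
        refine h x hx ⟨Fin.cons a b, fun y hy hy0 => ?_⟩
        by_contra hne
        refine hne (hb y ⟨hy, by simpa using hne, by simpa using hy0 0⟩ fun i => ?_)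
        simpa using hy0 i.succ)
    calc algDim Z + ((k + 1 + 1 : ℕ) : WithBot ℕ∞)
        = algDim Z + ((k + 1 : ℕ) : WithBot ℕ∞) + 1 := by push_cast; simp only [add_assoc]
      _ ≤ _ := add_le_add_left h2 1
      _ ≤ _ := h1
      _ ≤ _ := algDim_mono fun p hp => hp.1

theorem not_isCutBy_iff {τ : Type} [Fintype τ] (k : ℕ) {W : Set (τ → ℂ)} (hW : IsCone W)
    (hcl : zeroLocus ℂ (vanishingIdeal ℂ W) ⊆ W) :
    ¬ IsCutBy k W ↔ ((k + 1 : ℕ) : WithBot ℕ∞) ≤ algDim W := by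
  refine ⟨fun h => ?_, fun h hc => ?_⟩
  -- View W as a family over the one-point space ℂ^∅.
  · have h1 := algDim_add_le_of_not_isCutBy (σ := Empty) Set.univ k
      {p | p ∘ Sum.inr ∈ W} (fun t ht x y hy => hW t ht y hy) fun _ _ => h
    have h2 := (add_le_add_left (algDim_nonneg (V := (Set.univ : Set (Empty → ℂ)))
      Set.univ_nonempty) ((k + 1 : ℕ) : WithBot ℕ∞)).trans h1
    rw [zero_add] at h2
    refine h2.trans (algDim_le_of_surjective (rename Sum.inr) (fun p => ?_) fun f hf p hp => ?_)
    · refine ⟨rename (Sum.elim (fun i => i.elim) id) p, ?_⟩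
      rw [rename_rename]
      convert rename_id_apply p
      ext i
      rcases i with i | i
      · exact i.elim
      · rfl
    · rw [aeval_rename]
      exact hf _ hp
  · have := h.trans (algDim_le_of_isCutBy hW hcl hc)
    exact absurd (WithBot.coe_le_coe.1 this) (by
      rw [not_le]
      exact_mod_cast Nat.lt_succ_self k)

/-! ### Families of cones and openness -/

/-- The fibre at `x` of the family of algebraic sets given by polynomials with polynomial
coefficients. -/
def familyFibre {σ τ ι : Type} (G : ι → MvPolynomial τ (MvPolynomial σ ℂ)) (x : σ → ℂ) :
    Set (τ → ℂ) :=
  {y | ∀ i, eval y (map (eval x) (G i)) = 0}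

/-- The total space of the family of algebraic sets given by polynomials with polynomial
coefficients. -/
def familyTotal {σ τ ι : Type} (G : ι → MvPolynomial τ (MvPolynomial σ ℂ)) : Set (σ ⊕ τ → ℂ) :=
  {p | (p ∘ Sum.inr) ∈ familyFibre G (p ∘ Sum.inl)}

theorem map_homogeneousComponent {R S τ : Type*} [CommRing R] [CommRing S] (f : R →+* S)
    (p : MvPolynomial τ R) (n : ℕ) :
    map f (homogeneousComponent n p) = homogeneousComponent n (map f p) := by
  ext s
  simp only [coeff_map, coeff_homogeneousComponent]
  split_ifs <;> simp

attribute [local instance] MvPolynomial.gradedAlgebra in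
theorem homogeneousComponent_mem_span {R τ ι : Type*} [CommRing R] {G : ι → MvPolynomial τ R}
    {d : ι → ℕ} (hG : ∀ i, (G i).IsHomogeneous (d i)) {g : MvPolynomial τ R}
    (hg : g ∈ Ideal.span (Set.range G)) (n : ℕ) :
    homogeneousComponent n g ∈ Ideal.span (Set.range G) := by
  refine homogeneousComponent_mem_of_mem (Ideal.homogeneous_span _ _ ?_) hg n
  rintro _ ⟨i, rfl⟩
  exact ⟨d i, hG i⟩

/-- A form of degree `n` with coefficients in `I` lies in `I` times the forms of degree `n`. -/
theorem mem_smul_homogeneousSubmodule {R τ : Type*} [CommRing R] {I : Ideal R} {n : ℕ}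
    {p : MvPolynomial τ R} (hp : p.IsHomogeneous n) (hI : ∀ s, coeff s p ∈ I) :
    p ∈ I • homogeneousSubmodule τ R n := by
  rw [p.as_sum]
  refine Submodule.sum_mem _ fun s hs => ?_
  rw [← mul_one (coeff s p), ← smul_eq_mul, ← smul_monomial]
  exact Submodule.smul_mem_smul (hI s) (isHomogeneous_monomial 1
    (not_imp_comm.1 hp.coeff_eq_zero (mem_support_iff.1 hs)))

/-- For a family of cones, the condition that the fibre is the origin is Zariski open. -/
theorem exists_eval_ne_zero_of_familyFibre_subset {σ τ ι : Type} [Finite τ]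
    {G : ι → MvPolynomial τ (MvPolynomial σ ℂ)} {d : ι → ℕ} (hG : ∀ i, (G i).IsHomogeneous (d i))
    {x₀ : σ → ℂ} (h : ∀ y ∈ familyFibre G x₀, y = 0) :
    ∃ f : MvPolynomial σ ℂ, eval x₀ f ≠ 0 ∧
      ∀ x, eval x f ≠ 0 → ∀ y ∈ familyFibre G x, y = 0 := by
  have hsurj : Function.Surjective (map (eval x₀) : MvPolynomial τ _ →+* MvPolynomial τ ℂ) :=
    map_surjective _ fun c => ⟨C c, eval_C c⟩
  obtain ⟨N, hN⟩ := exists_forall_isHomogeneous_mem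
    (J := (Ideal.span (Set.range G)).map (map (eval x₀))) (by
      intro y hy
      exact h y fun i => hy _ (Ideal.mem_map_of_mem _ (Ideal.subset_span ⟨i, rfl⟩)))
  -- Nakayama: forms of degree N over ℂ[x] lie in the ideal of G plus the maximal ideal at x₀ times
  -- such forms. So some r with r(x₀) = 1 multiplies all of them into the ideal of G; where r(x) ≠
  -- 0, this forces y_j^N = 0.
  obtain ⟨r, hr, hrP⟩ := Submodule.exists_sub_one_mem_and_smul_le_of_fg_of_le_sup
    (I := RingHom.ker (eval x₀))
    (N := (Ideal.span (Set.range G)).restrictScalars (MvPolynomial σ ℂ))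
    (homogeneousSubmodule_fg (σ := τ) (R := MvPolynomial σ ℂ) N) le_rfl (by
      intro p hp
      obtain ⟨g, hg, hgp⟩ := (Ideal.mem_map_iff_of_surjective _ hsurj).1
        (hN N le_rfl (map (eval x₀) p) (IsHomogeneous.map hp _))
      refine Submodule.mem_sup.2 ⟨homogeneousComponent N g, homogeneousComponent_mem_span hG hg N,
        p - homogeneousComponent N g, ?_, by abel⟩
      refine mem_smul_homogeneousSubmodule
        (IsHomogeneous.sub hp (homogeneousComponent_isHomogeneous N g)) fun s => ?_
      rw [RingHom.mem_ker, ← coeff_map, map_sub, map_homogeneousComponent, hgp,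
        homogeneousComponent_eq_self (IsHomogeneous.map hp _), sub_self, coeff_zero])
  have hr1 : eval x₀ r = 1 := by
    rw [RingHom.mem_ker, map_sub, map_one] at hr
    exact sub_eq_zero.1 hr
  refine ⟨r, by simp [hr1], fun x hx y hy => funext fun j => ?_⟩
  have h1 : r • (X j : MvPolynomial τ (MvPolynomial σ ℂ)) ^ N ∈ Ideal.span (Set.range G) :=
    hrP (Submodule.smul_mem_pointwise_smul _ _ _ (by
      simpa using isHomogeneous_X_pow (R := MvPolynomial σ ℂ) j N))
  have h2 : Ideal.span (Set.range G) ≤ RingHom.ker ((eval y).comp (map (eval x))) := by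
    rw [Ideal.span_le]
    rintro _ ⟨i, rfl⟩
    exact hy i
  have h3 : eval x r * y j ^ N = 0 := by
    have := h2 h1
    rw [RingHom.mem_ker, smul_eq_C_mul] at this
    simpa using this
  exact eq_zero_of_pow_eq_zero ((mul_eq_zero.1 h3).resolve_left hx)

theorem isZariskiOpen_of_forall_exists {σ : Type} {U : Set (σ → ℂ)}
    (h : ∀ x ∈ U, ∃ f : MvPolynomial σ ℂ, eval x f ≠ 0 ∧ ∀ x', eval x' f ≠ 0 → x' ∈ U) :
    IsZariskiOpen U := by
  refine ⟨Ideal.span {f | ∀ x', eval x' f ≠ 0 → x' ∈ U}, ?_⟩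
  rw [zeroLocus_span]
  ext x
  refine ⟨fun hx f hf => ?_, fun hx hxU => ?_⟩
  · by_contra h0
    exact hx (hf x h0)
  · obtain ⟨f, hfx, hf⟩ := h x hxU
    exact hfx (hx f hf)

/-- The forms that work at x₀ work nearby: adjoined to G as constant equations, they reduce the
claim to fibres equal to the origin. -/
theorem isZariskiOpen_setOf_isCutBy {σ τ ι : Type} [Fintype τ]
    {G : ι → MvPolynomial τ (MvPolynomial σ ℂ)} {d : ι → ℕ} (hG : ∀ i, (G i).IsHomogeneous (d i))
    (k : ℕ) : IsZariskiOpen {x | IsCutBy k (familyFibre G x)} := by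
  refine isZariskiOpen_of_forall_exists fun x₀ ⟨a, ha⟩ => ?_
  have hmem : ∀ x y, y ∈ familyFibre (Sum.elim G fun i => linForm (MvPolynomial σ ℂ) (a i)) x ↔
      y ∈ familyFibre G x ∧ ∀ i, ∑ j, (a i j : ℂ) * y j = 0 := by
    intro x y
    refine ⟨fun h => ⟨fun i => h (Sum.inl i), fun i => ?_⟩, fun h => ?_⟩
    · rw [← eval_linForm, ← map_linForm (eval x)]
      exact h (Sum.inr i)
    · rintro (i | i)
      · exact h.1 i
      · rw [Sum.elim_inr, map_linForm, eval_linForm]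
        exact h.2 i
  obtain ⟨f, hf0, hf⟩ := exists_eval_ne_zero_of_familyFibre_subset
    (G := Sum.elim G fun i => linForm (MvPolynomial σ ℂ) (a i)) (d := Sum.elim d fun _ => 1)
    (x₀ := x₀) (by
      rintro (i | i)
      · exact hG i
      · exact isHomogeneous_linForm _ _) (fun y hy => by
      rw [hmem] at hy
      exact ha y hy.1 hy.2)
  exact ⟨f, hf0, fun x hx => ⟨a, fun y hy hy0 => hf x hx y ((hmem x y).2 ⟨hy, hy0⟩)⟩⟩

theorem isCone_familyFibre {σ τ ι : Type} {G : ι → MvPolynomial τ (MvPolynomial σ ℂ)} {d : ι → ℕ}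
    (hG : ∀ i, (G i).IsHomogeneous (d i)) (x : σ → ℂ) : IsCone (familyFibre G x) := by
  intro t _ y hy i
  rw [eval_smul_of_isHomogeneous ((hG i).map _), hy i, mul_zero]

theorem zeroLocus_vanishingIdeal_familyFibre {σ τ ι : Type}
    (G : ι → MvPolynomial τ (MvPolynomial σ ℂ)) (x : σ → ℂ) :
    zeroLocus ℂ (vanishingIdeal ℂ (familyFibre G x)) ⊆ familyFibre G x :=
  fun _ hy i => hy _ fun _ hz => hz i

theorem zero_mem_familyFibre {σ τ ι : Type} {G : ι → MvPolynomial τ (MvPolynomial σ ℂ)} {d : ι → ℕ}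
    (hG : ∀ i, (G i).IsHomogeneous (d i)) {x : σ → ℂ} {y : τ → ℂ} (hy : y ∈ familyFibre G x) :
    0 ∈ familyFibre G x := by
  intro i
  rw [← zero_smul ℂ y, eval_smul_of_isHomogeneous ((hG i).map _), hy i, mul_zero]

/-- In a family of cones, the points with nonempty fibre form a closed set. -/
theorem isZariskiOpen_setOf_familyFibre_eq_empty {σ τ ι : Type}
    {G : ι → MvPolynomial τ (MvPolynomial σ ℂ)} {d : ι → ℕ} (hG : ∀ i, (G i).IsHomogeneous (d i)) :
    IsZariskiOpen {x | ¬ (familyFibre G x).Nonempty} := by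
  refine isZariskiOpen_of_forall_exists fun x₀ hx₀ => ?_
  obtain ⟨i, hi⟩ : ∃ i, eval 0 (map (eval x₀) (G i)) ≠ 0 := by
    by_contra! h
    exact hx₀ ⟨0, h⟩
  have key : ∀ x, eval x (constantCoeff (G i)) = eval 0 (map (eval x) (G i)) := fun x => by
    rw [eval_zero, constantCoeff_map]
  refine ⟨constantCoeff (G i), by rwa [key], fun x hx => ?_⟩
  rintro ⟨y, hy⟩
  exact hx ((key x).trans (zero_mem_familyFibre hG hy i))

/-! ### Integer points on cones -/

theorem card_piFinset_Icc_le (e : ℕ) {K P : ℝ} (hK : 0 ≤ K) (hP : 1 ≤ P) :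
    ((Fintype.piFinset fun _ : Fin e => Finset.Icc (-⌊K * P⌋) ⌊K * P⌋).card : ℝ) ≤
      ((2 * K + 1) * P) ^ e := by
  rw [Fintype.card_piFinset, Finset.prod_const, Finset.card_univ, Fintype.card_fin, Nat.cast_pow]
  refine pow_le_pow_left₀ (Nat.cast_nonneg _) ?_ e
  have h0 : 0 ≤ ⌊K * P⌋ := Int.floor_nonneg.2 (by positivity)
  have h1 : ((Finset.Icc (-⌊K * P⌋) ⌊K * P⌋).card : ℤ) = 2 * ⌊K * P⌋ + 1 := by
    rw [Int.card_Icc, Int.toNat_of_nonneg (by lia)]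
    ring
  have h2 : ((Finset.Icc (-⌊K * P⌋) ⌊K * P⌋).card : ℝ) = 2 * ⌊K * P⌋ + 1 := by exact_mod_cast h1
  rw [h2]
  nlinarith [Int.floor_le (K * P)]

theorem exists_monic_eval_eq_zero {τ : Type} [Fintype τ] {e : ℕ} {Z : Set (τ → ℂ)}
    (hZ : IsCone Z) (hcl : zeroLocus ℂ (vanishingIdeal ℂ Z) ⊆ Z) {a : Fin e → τ → ℤ}
    (ha : ∀ y ∈ Z, (∀ i, ∑ j, (a i j : ℂ) * y j = 0) → y = 0) (j : τ) :
    ∃ p : Polynomial (MvPolynomial (Fin e) ℂ), p.Monic ∧ ∀ y ∈ Z,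
      (p.map (eval fun i => ∑ j, (a i j : ℂ) * y j)).eval (y j) = 0 := by
  obtain ⟨p, hp, hp0⟩ := linFormsMap_isIntegral
    (fun f hf n => homogeneousComponent_mem_vanishingIdeal hZ hf n) (fun y hy => ha y (hcl hy))
    (Ideal.Quotient.mk _ (X j))
  refine ⟨p, hp, fun y hy => ?_⟩
  have hle : ∀ f ∈ vanishingIdeal ℂ Z, eval y f = 0 := fun f hf => hf y hy
  have h1 := congrArg (Ideal.Quotient.lift (vanishingIdeal ℂ Z) (eval y) hle) hp0
  rw [Polynomial.hom_eval₂, map_zero, Ideal.Quotient.lift_mk, eval_X] at h1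
  rw [Polynomial.eval_map, ← h1]
  congr 1
  refine MvPolynomial.ringHom_ext (fun c => ?_) fun i => ?_
  · simp [linFormsMap, algHom_C]
  · simp [linFormsMap, eval_linForm]

/-- The e integral forms send integer points of the box to integer points of size at most KP. Once
their values are fixed, each coordinate is a root of a fixed-degree monic polynomial, so fibres have
at most D points. -/
theorem exists_ncard_boxIntPoints_le {s e : ℕ} {Z : Set (Fin s → ℂ)}
    (hZ : IsCone Z) (hcl : zeroLocus ℂ (vanishingIdeal ℂ Z) ⊆ Z) (h : IsCutBy e Z) :
    ∃ C : ℝ, 0 < C ∧ ∀ P : ℝ, 1 ≤ P → ((boxIntPoints Z P).ncard : ℝ) ≤ C * P ^ e := by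
  classical
  obtain ⟨a, ha⟩ := h
  choose p hp hp0 using exists_monic_eval_eq_zero hZ hcl ha
  let K : ℝ := ∑ i, ∑ j, |(a i j : ℝ)|
  have hK : 0 ≤ K := Finset.sum_nonneg fun i _ => Finset.sum_nonneg fun j _ => abs_nonneg _
  let D : ℕ := ∏ j, (p j).natDegree
  -- D + 1 rather than D keeps the constant positive when D = 0.
  refine ⟨(D + 1) * (2 * K + 1) ^ e, by positivity, fun P hP => ?_⟩
  have hfin : (boxIntPoints Z P).Finite := by
    refine (Finset.finite_toSet (Fintype.piFinset fun _ : Fin s => Finset.Icc (-⌊P⌋) ⌊P⌋)).subset ?_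
    intro b hb
    simp only [Finset.mem_coe, Fintype.mem_piFinset, Finset.mem_Icc, Int.le_floor]
    intro i
    have := abs_le.1 (hb.1 i)
    refine ⟨neg_le.1 (Int.le_floor.2 ?_), this.2⟩
    push_cast
    linarith
  rw [Set.ncard_eq_toFinset_card _ hfin]
  have hmaps : ∀ b ∈ hfin.toFinset, (fun i => ∑ j, a i j * b j) ∈
      Fintype.piFinset fun _ : Fin e => Finset.Icc (-⌊K * P⌋) ⌊K * P⌋ := by
    intro b hb
    rw [Set.Finite.mem_toFinset] at hb
    rw [Fintype.mem_piFinset]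
    intro i
    have : |((∑ j, a i j * b j : ℤ) : ℝ)| ≤ K * P := by
      push_cast
      calc |∑ j, (a i j : ℝ) * b j| ≤ ∑ j, |(a i j : ℝ) * b j| := Finset.abs_sum_le_sum_abs _ _
        _ ≤ ∑ j, |(a i j : ℝ)| * P := Finset.sum_le_sum fun j _ => by
          rw [abs_mul]
          exact mul_le_mul_of_nonneg_left (hb.1 j) (abs_nonneg _)
        _ = (∑ j, |(a i j : ℝ)|) * P := (Finset.sum_mul _ _ _).symm
        _ ≤ K * P := mul_le_mul_of_nonneg_right
          (Finset.single_le_sum (f := fun i => ∑ j, |(a i j : ℝ)|)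
            (fun i _ => Finset.sum_nonneg fun j _ => abs_nonneg _) (Finset.mem_univ i))
          (by linarith)
    have h2 := abs_le.1 this
    rw [Finset.mem_Icc]
    refine ⟨neg_le.1 (Int.le_floor.2 ?_), Int.le_floor.2 h2.2⟩
    rw [Int.cast_neg]
    linarith
  have hfib : ∀ c ∈ Fintype.piFinset fun _ : Fin e => Finset.Icc (-⌊K * P⌋) ⌊K * P⌋,
      (hfin.toFinset.filter fun b => (fun i => ∑ j, a i j * b j) = c).card ≤ D := by
    intro c _
    calc _ ≤ (Fintype.piFinset fun j =>
          ((p j).map (eval fun i => (c i : ℂ))).roots.toFinset).card := by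
          refine Finset.card_le_card_of_injOn (fun b j => (b j : ℂ)) ?_ ?_
          · intro b hb
            rw [Finset.mem_coe, Finset.mem_filter, Set.Finite.mem_toFinset] at hb
            rw [Finset.mem_coe, Fintype.mem_piFinset]
            intro j
            rw [Multiset.mem_toFinset, Polynomial.mem_roots ((hp j).map _).ne_zero]
            have := hp0 j _ hb.1.2
            rw [← hb.2]
            simpa [Polynomial.IsRoot] using this
          · intro b _ b' _ hbb
            ext j
            exact Int.cast_injective (congrFun hbb j)
      _ ≤ D := by
          rw [Fintype.card_piFinset]
          refine Finset.prod_le_prod' fun j _ => ?_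
          refine (Multiset.toFinset_card_le _).trans ((Polynomial.card_roots' _).trans ?_)
          exact Polynomial.natDegree_map_le
  have hcard := Finset.card_le_mul_card_image_of_maps_to hmaps D hfib
  calc (hfin.toFinset.card : ℝ) ≤ D * (Fintype.piFinset fun _ : Fin e =>
        Finset.Icc (-⌊K * P⌋) ⌊K * P⌋).card := by exact_mod_cast hcard
    _ ≤ (D + 1) * ((2 * K + 1) * P) ^ e := by
      refine mul_le_mul (by linarith) (card_piFinset_Icc_le e hK hP) (Nat.cast_nonneg _)
        (by positivity)
    _ = _ := by rw [mul_pow, mul_assoc]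

/-! ### Loci of large fibre dimension -/

theorem algDim_eq_bot_iff {σ : Type} {V : Set (σ → ℂ)} : algDim V = ⊥ ↔ ¬ V.Nonempty := by
  refine ⟨fun h hV => ?_, fun h => ?_⟩
  · have := algDim_nonneg hV
    simp [h] at this
  · rw [Set.not_nonempty_iff_eq_empty.1 h, algDim_empty]

theorem zeroLocus_vanishingIdeal_of_isZariskiOpen_compl {σ : Type} {Z : Set (σ → ℂ)}
    (h : IsZariskiOpen Zᶜ) : zeroLocus ℂ (vanishingIdeal ℂ Z) ⊆ Z := by
  obtain ⟨I, hI⟩ := h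
  rw [compl_compl] at hI
  subst hI
  exact zeroLocus_anti_mono (le_vanishingIdeal_zeroLocus I)

/-- The bound 0 means a nonempty fibre and is treated apart; k + 1 means not cut by k forms. -/
theorem isZariskiOpen_compl_setOf_le_algDim {σ τ ι : Type} [Fintype τ]
    {G : ι → MvPolynomial τ (MvPolynomial σ ℂ)} {d : ι → ℕ} (hG : ∀ i, (G i).IsHomogeneous (d i))
    (k : ℕ) : IsZariskiOpen {x | (k : WithBot ℕ∞) ≤ algDim (familyFibre G x)}ᶜ := by
  cases k with
  | zero =>
    convert isZariskiOpen_setOf_familyFibre_eq_empty hG using 1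
    ext x
    rw [Set.mem_compl_iff, Set.mem_ofPred_eq, Set.mem_ofPred_eq, ← algDim_eq_bot_iff]
    generalize algDim (familyFibre G x) = D
    cases D <;> simp
  | succ k =>
    convert isZariskiOpen_setOf_isCutBy hG k using 1
    ext x
    rw [Set.mem_compl_iff, Set.mem_ofPred_eq, Set.mem_ofPred_eq, not_iff_comm]
    exact not_isCutBy_iff k (isCone_familyFibre hG x) (zeroLocus_vanishingIdeal_familyFibre G x)

theorem algDim_setOf_le_algDim_add_le {σ τ ι : Type} [Fintype σ] [Fintype τ]
    {G : ι → MvPolynomial τ (MvPolynomial σ ℂ)} {d : ι → ℕ} (hG : ∀ i, (G i).IsHomogeneous (d i))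
    (k : ℕ) : algDim {x | (k : WithBot ℕ∞) ≤ algDim (familyFibre G x)} + k ≤
      algDim (familyTotal G) := by
  have hcone : ∀ t : ℂ, t ≠ 0 → ∀ x y, Sum.elim x y ∈ familyTotal G →
      Sum.elim x (t • y) ∈ familyTotal G := fun t ht x y hy => isCone_familyFibre hG x t ht y hy
  cases k with
  | zero =>
    rw [Nat.cast_zero, add_zero]
    refine algDim_le_of_fibre_nonempty _ _ hcone fun x hx => ?_
    by_contra hc
    have : algDim (familyFibre G x) = ⊥ := algDim_eq_bot_iff.2 hc
    rw [Set.mem_ofPred_eq, this] at hx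
    simp at hx
  | succ k =>
    refine algDim_add_le_of_not_isCutBy _ k _ hcone fun x hx => ?_
    exact (not_isCutBy_iff k (isCone_familyFibre hG x)
      (zeroLocus_vanishingIdeal_familyFibre G x)).2 hx

theorem isZariskiOpen_empty {σ : Type} : IsZariskiOpen (∅ : Set (σ → ℂ)) :=
  ⟨⊥, by rw [zeroLocus_bot, Set.compl_empty]; rfl⟩

/-- Truncated subtraction is harmless: if the difference becomes 0, both sides consist of the points
with nonempty fibre. -/
theorem setOf_algDim_add_lt_compl {σ τ ι : Type} [Fintype τ]
    (G : ι → MvPolynomial τ (MvPolynomial σ ℂ)) {N : ℕ} (s ν : ℕ) :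
    {x | algDim (familyFibre G x) + (s : WithBot ℕ∞) < (N : WithBot ℕ∞) + (ν : WithBot ℕ∞)}ᶜ =
      {x | ((N + ν - s : ℕ) : WithBot ℕ∞) ≤ algDim (familyFibre G x)} := by
  ext x
  rw [Set.mem_compl_iff, Set.mem_ofPred_eq, Set.mem_ofPred_eq, not_lt]
  by_cases hx : (familyFibre G x).Nonempty
  · obtain ⟨n, hn⟩ := exists_algDim_eq hx
    rw [hn]
    norm_cast
    lia
  · rw [algDim_eq_bot_iff.2 hx, WithBot.bot_add]
    norm_cast
    simp

/-- In a family of cones over affine space, invariant under dilations of the base, the locus where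
the fibre dimension is not too large is open, and its complement contains few integer points. -/
theorem isZariskiOpen_and_ncard_le {s : ℕ} {τ ι : Type} [Fintype τ]
    {G : ι → MvPolynomial τ (MvPolynomial (Fin s) ℂ)} {d : ι → ℕ}
    (hG : ∀ i, (G i).IsHomogeneous (d i))
    (hscale : ∀ t : ℂ, t ≠ 0 → ∀ x, algDim (familyFibre G x) ≤ algDim (familyFibre G (t • x)))
    (ν : ℕ) {A : Set (Fin s → ℂ)}
    (hA : A = {x | algDim (familyFibre G x) + ((s : ℕ) : WithBot ℕ∞) <
      algDim (familyTotal G) + (ν : WithBot ℕ∞)}) :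
    IsZariskiOpen A ∧ ((familyTotal G).Nonempty → ∃ C : ℝ, 0 < C ∧ ∀ P : ℝ, 1 ≤ P →
      ((boxIntPoints Aᶜ P).ncard : ℝ) ≤ C * P ^ ((s : ℤ) - (ν : ℤ))) := by
  by_cases hV : (familyTotal G).Nonempty
  swap
  · refine ⟨?_, fun h => absurd h hV⟩
    rw [algDim_eq_bot_iff.2 hV] at hA
    simp only [WithBot.bot_add, not_lt_bot, Set.ofPred_false] at hA
    exact hA ▸ isZariskiOpen_empty
  obtain ⟨N, hN⟩ := exists_algDim_eq hV
  have hAc : Aᶜ = {x | ((N + ν - s : ℕ) : WithBot ℕ∞) ≤ algDim (familyFibre G x)} := by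
    rw [hA, hN, setOf_algDim_add_lt_compl]
  have hopen : IsZariskiOpen A := by
    rw [← compl_compl A, hAc]
    exact isZariskiOpen_compl_setOf_le_algDim hG _
  refine ⟨hopen, fun _ => ?_⟩
  by_cases hZ : (Aᶜ).Nonempty
  swap
  · refine ⟨1, one_pos, fun P hP => ?_⟩
    have : boxIntPoints Aᶜ P = ∅ := by
      rw [Set.eq_empty_iff_forall_notMem]
      exact fun b hb => hZ ⟨_, hb.2⟩
    rw [this, Set.ncard_empty, Nat.cast_zero]
    positivity
  obtain ⟨e, he⟩ := exists_algDim_eq hZ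
  -- This gives e ≤ s - ν in ℤ, also when N + ν < s and the subtraction truncates, since then e ≤ N.
  have hdim := algDim_setOf_le_algDim_add_le hG (N + ν - s)
  rw [← hAc, he, hN] at hdim
  have hdim' : e + (N + ν - s) ≤ N := by exact_mod_cast hdim
  have hcone : IsCone Aᶜ := by
    rw [hAc]
    exact fun t ht x hx => le_trans hx (hscale t ht x)
  have hcl : zeroLocus ℂ (vanishingIdeal ℂ Aᶜ) ⊆ Aᶜ :=
    zeroLocus_vanishingIdeal_of_isZariskiOpen_compl (by rwa [compl_compl])
  have hcut : IsCutBy e Aᶜ := by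
    by_contra hc
    rw [not_isCutBy_iff e hcone hcl, he] at hc
    have : e + 1 ≤ e := by exact_mod_cast hc
    lia
  obtain ⟨C, hC, hbound⟩ := exists_ncard_boxIntPoints_le hcone hcl hcut
  refine ⟨C, hC, fun P hP => (hbound P hP).trans (mul_le_mul_of_nonneg_left ?_ hC.le)⟩
  rw [← zpow_natCast]
  exact zpow_le_zpow_right₀ hP (by lia)

/-! ### Application to the partial derivatives of F -/

theorem algDim_le_of_scale {τ : Type} {V W : Set (τ → ℂ)} (c : τ → ℂ) (hc : ∀ j, c j ≠ 0)
    (h : ∀ y ∈ V, (fun j => c j * y j) ∈ W) : algDim V ≤ algDim W := by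
  refine algDim_le_of_surjective (aeval fun j => C (c j) * X j) (fun p => ?_) fun f hf y hy => ?_
  · refine ⟨aeval (fun j => C (c j)⁻¹ * X j) p, ?_⟩
    rw [← AlgHom.comp_apply, comp_aeval]
    convert aeval_X_left_apply p with j
    rw [map_mul, algHom_C, aeval_X, algebraMap_eq, ← mul_assoc, ← C_mul, inv_mul_cancel₀ (hc j),
      C_1, one_mul]
  · rw [← AlgHom.comp_apply, comp_aeval, ← hf _ (h y hy)]
    simp

theorem algDim_setOf_comp_equiv_mem {σ τ : Type} (e : σ ≃ τ) (V : Set (σ → ℂ)) :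
    algDim {p : τ → ℂ | p ∘ e ∈ V} = algDim V := by
  refine le_antisymm ?_ ?_
  · refine algDim_le_of_surjective (renameEquiv ℂ e).toAlgHom (renameEquiv ℂ e).surjective
      fun f hf p hp => ?_
    change aeval p (rename e f) = 0
    rw [aeval_rename]
    exact hf _ hp
  · refine algDim_le_of_surjective (renameEquiv ℂ e.symm).toAlgHom
      (renameEquiv ℂ e.symm).surjective fun f hf p hp => ?_
    change aeval p (rename e.symm f) = 0
    rw [aeval_rename]
    refine hf _ ?_
    rw [Set.mem_ofPred_eq, Function.comp_assoc, Equiv.symm_comp_self]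
    exact hp

/-- A polynomial in variables distributed over two blocks, as a polynomial in the second block
with coefficients in the first. -/
noncomputable def toFamily {κ σ τ : Type} (e : κ → σ ⊕ τ) (P : MvPolynomial κ ℚ) :
    MvPolynomial τ (MvPolynomial σ ℂ) :=
  aeval (fun i => Sum.elim (fun a => C (X a)) X (e i)) P

theorem eval_map_toFamily {κ σ τ : Type} (e : κ → σ ⊕ τ) (P : MvPolynomial κ ℚ) (x : σ → ℂ)
    (y : τ → ℂ) :
    eval y (map (eval x) (toFamily e P)) = aeval (fun i => Sum.elim x y (e i)) P := by
  refine RingHom.congr_fun (f := ((eval y).comp (map (eval x))).comp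
    (aeval (fun i => Sum.elim (fun a => C (X a)) X (e i)) :
      MvPolynomial κ ℚ →ₐ[ℚ] MvPolynomial τ (MvPolynomial σ ℂ)).toRingHom)
    (MvPolynomial.ringHom_ext (fun c => ?_) fun i => ?_) P
  · simp
  · rcases h : e i with a | b <;> simp [h]

theorem isHomogeneous_toFamily {κ σ τ : Type} (e : κ → σ ⊕ τ) {P : MvPolynomial κ ℚ} {w : κ → ℕ}
    {d : ℕ} (hP : IsWeightedHomogeneous w P d)
    (hw : ∀ i, w i = Sum.elim (fun _ => 0) (fun _ => 1) (e i)) :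
    (toFamily e P).IsHomogeneous d := by
  unfold toFamily
  rw [aeval_def, eval₂_eq]
  refine IsHomogeneous.sum _ _ _ fun s hs => ?_
  have h1 : Finsupp.weight w s = d := hP (mem_support_iff.1 hs)
  rw [← h1, Finsupp.weight_apply, Finsupp.sum, ← zero_add (∑ i ∈ s.support, _)]
  refine IsHomogeneous.mul (isHomogeneous_C _ _) (IsHomogeneous.prod _ _ _ fun i _ => ?_)
  rw [smul_eq_mul, mul_comm]
  refine IsHomogeneous.pow ?_ _
  rw [hw]
  rcases e i with a | b
  · exact isHomogeneous_C _ _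
  · exact isHomogeneous_X _ _

/-- If w i > d, the derivative is zero and the truncated degree does no harm. -/
theorem isWeightedHomogeneous_pderiv_sub {κ : Type} {w : κ → ℕ} {P : MvPolynomial κ ℚ} {d : ℕ}
    (hP : IsWeightedHomogeneous w P d) (i : κ) :
    IsWeightedHomogeneous w (pderiv i P) (d - w i) := by
  intro m hm
  rw [coeff_pderiv] at hm
  have := hP (left_ne_zero_of_mul hm)
  rw [map_add, Finsupp.weight_single, one_smul] at this
  lia

theorem aeval_pderiv_scale {κ : Type} {w : κ → ℕ} {P : MvPolynomial κ ℚ} {d : ℕ}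
    (hP : IsWeightedHomogeneous w P d) (i : κ) (t : ℂ) {p q : κ → ℂ}
    (hq : ∀ j, q j = t ^ w j * p j) (h : aeval p (pderiv i P) = 0) :
    aeval q (pderiv i P) = 0 := by
  rw [funext hq, aeval_weight_scale (isWeightedHomogeneous_pderiv_sub hP i), h, mul_zero]

theorem familyFibre_toFamily_V2 {r m n : ℕ} (F : MvPolynomial (XYZIdx r m n) ℚ) (x : XIdx r → ℂ) :
    familyFibre (fun i : YIdx r m ⊕ ZIdx m n => toFamily id (pderiv (Sum.inr i) F)) x =
      V2Fibre F x := by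
  ext q
  have hq : xyzPoint x (fun j => q (Sum.inl j)) (fun k => q (Sum.inr k)) = Sum.elim x q := by
    ext i
    rcases i with i | i | i <;> rfl
  simp only [familyFibre, V2Fibre, V2Star, partialAt, hq, Set.mem_ofPred_eq, Sum.forall,
    eval_map_toFamily]
  rfl

theorem familyTotal_toFamily_V2 {r m n : ℕ} (F : MvPolynomial (XYZIdx r m n) ℚ) :
    familyTotal (fun i : YIdx r m ⊕ ZIdx m n => toFamily id (pderiv (Sum.inr i) F)) =
      V2Star F := by
  ext p
  have hp : Sum.elim (p ∘ Sum.inl) (p ∘ Sum.inr) = p := Sum.elim_comp_inl_inr p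
  simp only [familyTotal, familyFibre, V2Star, partialAt, Set.mem_ofPred_eq, Sum.forall,
    eval_map_toFamily, id, hp]

/-- The reordering `(x, y, z) ↦ (z, (x, y))` of the blocks of coordinates. -/
def zFirst (r m n : ℕ) : XYZIdx r m n ≃ ZIdx m n ⊕ (XIdx r ⊕ YIdx r m) :=
  (Equiv.sumAssoc _ _ _).symm.trans (Equiv.sumComm _ _)

/-- The variables `x`, `y` among all the variables. -/
def xyIdx (r m n : ℕ) : XIdx r ⊕ YIdx r m → XYZIdx r m n :=
  Sum.elim Sum.inl fun j => Sum.inr (Sum.inl j)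

theorem familyFibre_toFamily_V1 {r m n : ℕ} (F : MvPolynomial (XYZIdx r m n) ℚ) (z : ZIdx m n → ℂ) :
    familyFibre (fun i => toFamily (zFirst r m n) (pderiv (xyIdx r m n i) F)) z =
      V1Fibre F z := by
  ext q
  have hq : (fun i => Sum.elim z q (zFirst r m n i)) =
      xyzPoint (fun i => q (Sum.inl i)) (fun j => q (Sum.inr j)) z := by
    ext i
    rcases i with i | i | i <;> rfl
  simp only [familyFibre, V1Fibre, V1Star, partialAt, Set.mem_ofPred_eq, Sum.forall,
    eval_map_toFamily, hq]
  rfl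

theorem familyTotal_toFamily_V1 {r m n : ℕ} (F : MvPolynomial (XYZIdx r m n) ℚ) :
    familyTotal (fun i => toFamily (zFirst r m n) (pderiv (xyIdx r m n i) F)) =
      {p | p ∘ (zFirst r m n) ∈ V1Star F} := by
  ext p
  have hp : (fun i => Sum.elim (p ∘ Sum.inl) (p ∘ Sum.inr) (zFirst r m n i)) =
      p ∘ (zFirst r m n) := by
    rw [Sum.elim_comp_inl_inr]
    rfl
  simp only [familyTotal, familyFibre, V1Star, partialAt, Set.mem_ofPred_eq, Sum.forall,
    eval_map_toFamily, hp]
  rfl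

theorem mainTheorem8 (r m n d₁ d₂ : ℕ) (hrm : r ≤ m) (hmn : m ≤ n)
    (F : MvPolynomial (XYZIdx r m n) ℚ) (hF : IsBihomogeneous F d₁ d₂) :
    (∀ ν : ℕ, IsZariskiOpen (A2 F ν) ∧
      ((V2Star F).Nonempty → ∃ C : ℝ, 0 < C ∧ ∀ P₁ : ℝ, 1 ≤ P₁ →
        ((boxIntPoints (A2 F ν)ᶜ P₁).ncard : ℝ) ≤ C * P₁ ^ ((r : ℤ) + 1 - (ν : ℤ)))) ∧
    (∀ μ : ℕ, IsZariskiOpen (A1 F μ) ∧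
      ((V1Star F).Nonempty → ∃ C : ℝ, 0 < C ∧ ∀ P₂ : ℝ, 1 ≤ P₂ →
        ((boxIntPoints (A1 F μ)ᶜ P₂).ncard : ℝ) ≤
          C * P₂ ^ ((n : ℤ) - (m : ℤ) + 1 - (μ : ℤ)))) := by
  obtain ⟨hF₁, hF₂⟩ := hF
  refine ⟨fun ν => ?_, fun μ => ?_⟩
  · have key := isZariskiOpen_and_ncard_le
      (G := fun i : YIdx r m ⊕ ZIdx m n => toFamily id (pderiv (Sum.inr i) F))
      (fun i => isHomogeneous_toFamily id (isWeightedHomogeneous_pderiv_sub hF₂ (Sum.inr i)) (by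
        rintro (i | i | i) <;> rfl))
      -- Homogeneity in (x, y) sends the fibre over x into the fibre over tx by (y, z) ↦ (ty, z).
      (fun t ht x => algDim_le_of_scale (Sum.elim (fun _ => t) fun _ => 1)
        (by rintro (j | j) <;> simp [ht]) fun y hy i => by
          have hi := hy i
          rw [eval_map_toFamily] at hi ⊢
          refine aeval_pderiv_scale hF₁ _ t (fun j => ?_) hi
          rcases j with j | j | j <;> simp [weightXY])
      ν (A := A2 F ν) (by
        rw [familyTotal_toFamily_V2]
        simp only [familyFibre_toFamily_V2]
        rfl)
    rw [familyTotal_toFamily_V2] at key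
    simpa only [Nat.cast_add, Nat.cast_one] using key
  · have key := isZariskiOpen_and_ncard_le
      (G := fun i => toFamily (zFirst r m n) (pderiv (xyIdx r m n i) F))
      (fun i => isHomogeneous_toFamily _ (isWeightedHomogeneous_pderiv_sub hF₁ (xyIdx r m n i)) (by
        rintro (i | i | i) <;> rfl))
      -- Here z is the base, and (x, y) ↦ (x, ty) maps the fibre over z into the fibre over tz.
      (fun t ht x => algDim_le_of_scale (Sum.elim (fun _ => 1) fun _ => t)
        (by rintro (j | j) <;> simp [ht]) fun y hy i => by
          have hi := hy i
          rw [eval_map_toFamily] at hi ⊢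
          refine aeval_pderiv_scale hF₂ _ t (fun j => ?_) hi
          rcases j with j | j | j <;> simp [weightYZ, zFirst])
      μ (A := A1 F μ) (by
        rw [familyTotal_toFamily_V1, algDim_setOf_comp_equiv_mem (zFirst r m n)]
        simp only [familyFibre_toFamily_V1]
        rfl)
    refine ⟨key.1, fun hV => ?_⟩
    have h1 := key.2 (by
      obtain ⟨p, hp⟩ := hV
      rw [familyTotal_toFamily_V1]
      refine ⟨p ∘ (zFirst r m n).symm, ?_⟩
      rw [Set.mem_ofPred_eq]
      convert hp
      ext i
      simp)
    have h2 : ((n - m + 1 : ℕ) : ℤ) = (n : ℤ) - m + 1 := by lia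
    rwa [h2] at h1
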